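/- Let $N\ge 4$ be even, put $n=N-1$, and let $\mathbf e_1,\dots,\mathbf e_n$ be the standard basis of $\mathbb R^n$, with the convention $\mathbf e_0=\mathbf e_{N}=\mathbf 0$. Let $C_N$ be the cycle graph with nodes $0,\dots,n$ and edge set $\mathcal E(C_N)=\{\{0,1\},\{1,2\},\dots,\{n-1,n\},\{n,0\}\}$, and let $$S_{C_N}=\{\mathbf 0\}\cup\{\mathbf e_i-\mathbf e_j \mid \{i,j\}\in\mathcal E(C_N)\}\subset\mathbb R^n .$$ Let $\omega:S_{C_N}\to\mathbb Z$ be the height function with $\omega(\mathbf 0)=0$, $\omega(\pm\mathbf e_1)=2$ and $\omega(\mathbf a)=1$ for all other $\mathbf a\in S_{C_N}$. Let $\Delta_N$ be the regular subdivision of $\operatorname{conv}S_{C_N}$ induced by $\omega$, that is, the set of projections to $\mathbb R^n$ of the lower facets of the lifted polytope $\operatorname{conv}\{(\mathbf a,\omega(\mathbf a))\mid \mathbf a\in S_{C_N}\}\subset\mathbb R^{n+1}$, where a lower facet is an $n$-dimensional face with an inner normal vector whose last entry is positive. Then $\Delta_N$ is a (regular) unimodular triangulation of the point configuration $S_{C_N}$: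 its members are finitely many $n$-dimensional simplices with vertices in $S_{C_N}$, any two of which meet in the empty set or in a common face, whose union is $\operatorname{conv}S_{C_N}$, and each of which is a lattice simplex with normalized volume $n!\operatorname{vol}=1$. Specifically, $$\Delta_N=\bigcup_{\boldsymbol\lambda\in\Lambda_N}\Delta_+(G^{\mathbf 0}_{\boldsymbol\lambda}),\qquad \Lambda_N=\Big\{(\lambda_1,\dots,\lambda_N)\in\{-1,1\}^N \;\Big|\; \sum_{i=1}^N\lambda_i=0\Big\},$$ where, for $\boldsymbol\lambda\in\Lambda_N$, one puts $\mathbf v_0=\mathbf 0$, $\mathbf v_i=\lambda_i(\mathbf e_{i-1}-\mathbf e_i)$ for $1\le i\le N$, $V_{\boldsymbol\lambda}=\{\mathbf v_0,\dots,\mathbf v_N\}$, $G^{\mathbf 0}_{\boldsymbol\lambda}=\operatorname{conv}V_{\boldsymbol\lambda}$, and $$\Delta_+(G^{\mathbf 0}_{\boldsymbol\lambda})=\{\operatorname{conv}(V_{\boldsymbol\lambda}\setminus\{\mathbf v_i\})\mid 1\le i\le N,\ \lambda_i=\lambda_1\}.$$ -/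

import Mathlib

namespace AdjacencyPolytope

/-! ### Polytopes, subdivisions and triangulations in `ℝⁿ` -/

/-- The dimension of (the affine hull of) a subset of a real vector space. -/
noncomputable def dim {E : Type*} [AddCommGroup E] [Module ℝ E] (P : Set E) : ℕ :=
  Module.finrank ℝ (vectorSpan ℝ P)

/-- A subdivision of an `n`-dimensional polytope `P` in `ℝⁿ`: a finite collection of polytopes of
dimension `n` with union `P`, such that the intersection of any two of them is empty or
a face of both (`IsExposed` allows the empty set). -/
structure IsSubdivision {n : ℕ} (P : Set (Fin n → ℝ)) (C : Set (Set (Fin n → ℝ))) : Prop where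
  finite : C.Finite
  polytope : ∀ T ∈ C, ∃ s : Finset (Fin n → ℝ), T = convexHull ℝ (s : Set (Fin n → ℝ))
  dim_eq : ∀ T ∈ C, dim T = n
  face : ∀ T ∈ C, ∀ T' ∈ C, IsExposed ℝ T (T ∩ T') ∧ IsExposed ℝ T' (T ∩ T')
  cover : ⋃₀ C = P

/-- `T` is a simplex all of whose vertices lie in the set `S`. -/
def IsSimplexIn {n : ℕ} (S T : Set (Fin n → ℝ)) : Prop :=
  ∃ s : Set (Fin n → ℝ), s ⊆ S ∧ AffineIndependent ℝ ((↑) : s → Fin n → ℝ) ∧ T = convexHull ℝ s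

/-- A triangulation of the point configuration `S`: a subdivision of the convex hull of `S`
into simplices with vertices in `S`. -/
structure IsTriangulation {n : ℕ} (S : Set (Fin n → ℝ)) (C : Set (Set (Fin n → ℝ))) : Prop where
  subdivision : IsSubdivision (convexHull ℝ S) C
  simplex : ∀ T ∈ C, IsSimplexIn S T

/-- The lattice `ℤⁿ` in `ℝⁿ`. -/
def latticePoints (n : ℕ) : Set (Fin n → ℝ) :=
  {x | ∀ k, ∃ m : ℤ, x k = m}

/-- The normalized volume `n! vol(P)` of a subset of `ℝⁿ`. -/
noncomputable def normalizedVolume {n : ℕ} (P : Set (Fin n → ℝ)) : ENNReal :=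
  (n.factorial : ENNReal) * MeasureTheory.volume P

/-- A collection of cells is unimodular if all of them are lattice simplices of
normalized volume 1. -/
def IsUnimodular {n : ℕ} (C : Set (Set (Fin n → ℝ))) : Prop :=
  ∀ T ∈ C, IsSimplexIn (latticePoints n) T ∧ normalizedVolume T = 1

/-! ### Regular subdivisions -/

/-- The lifted polytope in `ℝⁿ × ℝ` of a point configuration `S` with heights `w`. -/
def liftedPolytope {n : ℕ} (S : Set (Fin n → ℝ)) (w : S → ℝ) : Set ((Fin n → ℝ) × ℝ) :=
  convexHull ℝ (Set.range fun a : S => ((a : Fin n → ℝ), w a))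

/-- `F` is a lower facet of `Q ⊆ ℝⁿ × ℝ`: an `n`-dimensional face with an inner normal
vector `(c, t)` whose last entry `t` is positive. -/
def IsLowerFacet {n : ℕ} (Q F : Set ((Fin n → ℝ) × ℝ)) : Prop :=
  dim F = n ∧ ∃ (c : Fin n → ℝ) (t : ℝ), 0 < t ∧
    F = {p ∈ Q | ∀ q ∈ Q, c ⬝ᵥ p.1 + t * p.2 ≤ c ⬝ᵥ q.1 + t * q.2}

/-- The regular subdivision of the point configuration `S` induced by the heights `w`: the
projections to `ℝⁿ` of the lower facets of the lifted polytope. -/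
def regularSubdivision {n : ℕ} (S : Set (Fin n → ℝ)) (w : S → ℝ) : Set (Set (Fin n → ℝ)) :=
  {T | ∃ F, IsLowerFacet (liftedPolytope S w) F ∧ T = Prod.fst '' F}

/-! ### The support of the synchronization system of a graph -/

/-- The vectors `e₁, …, eₙ` of the standard basis of `ℝⁿ` (the coordinate with number `k : Fin n`
is the `(k+1)`-st one), with `e i = 0` for all other `i`, in particular `e₀ = eₙ₊₁ = 0`. -/
def e (n : ℕ) (i : ℕ) : Fin n → ℝ :=
  fun k => if (k : ℕ) + 1 = i then 1 else 0

/-- The support `S_G = {0} ∪ {e_i - e_j | {i,j} ∈ E(G)}` of a graph `G` on `{0, …, n}`. -/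
def support {n : ℕ} (G : SimpleGraph (Fin (n + 1))) : Set (Fin n → ℝ) :=
  {0} ∪ {x | ∃ i j : Fin (n + 1), G.Adj i j ∧ x = e n i - e n j}

open Classical in
/-- The height function: `0` at the origin, `2` at `±e₁`, and `1` at all other points. -/
noncomputable def height {n : ℕ} {S : Set (Fin n → ℝ)} (a : S) : ℤ :=
  if (a : Fin n → ℝ) = 0 then 0
  else if (a : Fin n → ℝ) = e n 1 ∨ (a : Fin n → ℝ) = -e n 1 then 2
  else 1

/-! ### The explicit triangulation for a cycle with `N = n + 1` nodes

An index `i : Fin (n + 1)` stands for the index `i + 1` of `λ₁, …, λ_N` and `v₁, …, v_N`. -/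

/-- The sign vectors in `{-1,1}^N` with sum zero. -/
def Lam (n : ℕ) : Set (Fin (n + 1) → ℤ) :=
  {l | (∀ i, l i = -1 ∨ l i = 1) ∧ ∑ i, l i = 0}

/-- The points `v_i = λ_i (e_{i-1} - e_i)`, `1 ≤ i ≤ N`. -/
def v {n : ℕ} (l : Fin (n + 1) → ℤ) (i : Fin (n + 1)) : Fin n → ℝ :=
  (l i : ℝ) • (e n (i : ℕ) - e n ((i : ℕ) + 1))

/-- The points `0, v₁, …, v_N`; their convex hull is the pyramid with apex `0` over the
convex hull of `v₁, …, v_N`. -/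
def pyramidVertices {n : ℕ} (l : Fin (n + 1) → ℤ) : Set (Fin n → ℝ) :=
  {0} ∪ Set.range (v l)

/-- The cells `conv({0, v₁, …, v_N} \ {v_i})` with `λ_i = λ₁`. -/
def deltaPlus {n : ℕ} (l : Fin (n + 1) → ℤ) : Set (Set (Fin n → ℝ)) :=
  {T | ∃ i, l i = l 0 ∧ T = convexHull ℝ (pyramidVertices l \ {v l i})}

end AdjacencyPolytope

/-!
Write `fᵢ = eᵢ - eᵢ₊₁` for the edge vectors of the cycle, indexed by `0 ≤ i ≤ n`. They span the
lattice, their only linear relation is `∑ fᵢ = 0`, and the configuration is `{0} ∪ {± fᵢ}` with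
heights `wᵢ = 2` for `i = 0` and `wᵢ = 1` otherwise (`weight`).

A linear functional `c` is given by the numbers `yⱼ = c · fⱼ`, which are arbitrary up to
`∑ yⱼ = 0`. The cell of `λ` that omits `vᵢ` is a lower facet if there is a `c` with
`yⱼ = λⱼ wⱼ` for `j ≠ i` and `|yᵢ| < wᵢ` (`IsCertificate`): the hyperplane of slope `c` through
the lifted origin then touches the lifts of the vertices of the cell and lies strictly below all
others. If `∑ λⱼ = 0` and `λᵢ = λ₀`, then `yᵢ` is forced to be `0`, or `±1` when `wᵢ = 2`, so such
a `c` exists (`exists_isCertificate`). Conversely, a hyperplane under a lower facet touches at least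
`n + 1` lifted points; as `∑ λⱼ wⱼ` is odd for every sign vector, it must pass through the lifted origin
and touch a lift of `± fⱼ` for all `j` but one, and parity then determines the remaining sign
(`exists_isCertificate_of_dim`). This identifies the regular subdivision.

Each cell is the image of the corner simplex `{x ≥ 0, ∑ xₖ ≤ 1}`, of volume `1 / n!`, under an
integer matrix of determinant `±1` (`abs_det_cellMap`), hence a unimodular simplex. Two cells meet
in a common face because the difference of their certificates has constant sign on each of them
and vanishes exactly on the intersection (`IsCertificate.isExposed_inter`). The cells cover the
polytope: a point is `∑ xⱼ fⱼ` with `∑ |xⱼ| ≤ 1`, where all `xⱼ` may be shifted by a constant; one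
separates the upper half of the `xⱼ` from the lower half by a sign vector `λ` with sum zero, and
shifts by the median `xᵢ` lying in the same half as `x₀`. Then
`∑ |xⱼ - xᵢ| = ∑ λⱼ xⱼ ≤ ∑ |xⱼ| ≤ 1`, which puts the point into the cell (`exists_mem_cell`).
-/

namespace AdjacencyPolytope

/-! ### The volume of the corner simplex -/

/-- The simplex `{x ≥ 0, ∑ xᵢ ≤ r}`. -/
def cornerSimplex (n : ℕ) (r : ℝ) : Set (Fin n → ℝ) :=
  {x | (∀ k, 0 ≤ x k) ∧ ∑ k, x k ≤ r}

lemma measurableSet_cornerSimplex (n : ℕ) (r : ℝ) : MeasurableSet (cornerSimplex n r) := by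
  have h : IsClosed (cornerSimplex n r) := by
    have : cornerSimplex n r = (⋂ k, {x | 0 ≤ x k}) ∩ {x | ∑ k, x k ≤ r} := by
      ext x; simp [cornerSimplex]
    rw [this]
    exact (isClosed_iInter fun k => isClosed_le continuous_const (continuous_apply k)).inter
      (isClosed_le (by fun_prop) continuous_const)
  exact h.measurableSet

/-- By induction on the dimension, integrating over the slices of constant first coordinate. -/
lemma volume_cornerSimplex (n : ℕ) : ∀ r : ℝ, 0 ≤ r →
    MeasureTheory.volume (cornerSimplex n r) = ENNReal.ofReal (r ^ n / n.factorial) := by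
  induction n with
  | zero =>
    intro r hr
    have : cornerSimplex 0 r = Set.univ := by
      ext x; simp [cornerSimplex, hr]
    rw [this, MeasureTheory.volume_pi, MeasureTheory.Measure.pi_univ]
    simp
  | succ n ih =>
    intro r hr
    have hmp := (MeasureTheory.volume_preserving_piFinSuccAbove (fun _ : Fin (n + 1) => ℝ) 0).symm
    rw [← hmp.measure_preimage (measurableSet_cornerSimplex _ _).nullMeasurableSet,
      MeasureTheory.Measure.volume_eq_prod, MeasureTheory.Measure.prod_apply
        (hmp.measurable (measurableSet_cornerSimplex _ _))]
    have hslice : ∀ t : ℝ, MeasureTheory.volume (Prod.mk t ⁻¹'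
        ((MeasurableEquiv.piFinSuccAbove (fun _ : Fin (n + 1) => ℝ) 0).symm ⁻¹'
          cornerSimplex (n + 1) r)) =
        (Set.Icc 0 r).indicator (fun t => ENNReal.ofReal ((r - t) ^ n / n.factorial)) t := by
      intro t
      by_cases ht : t ∈ Set.Icc 0 r
      · rw [Set.indicator_of_mem ht, ← ih (r - t) (by linarith [ht.2])]
        congr 1
        ext y
        simp [cornerSimplex, Fin.forall_fin_succ, Fin.sum_univ_succ,
          MeasurableEquiv.piFinSuccAbove, Fin.insertNthEquiv, ht.1, le_sub_iff_add_le']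
      · rw [Set.indicator_of_notMem ht]
        refine (congrArg _ ?_).trans MeasureTheory.measure_empty
        rw [Set.eq_empty_iff_forall_notMem]
        rintro y hy
        simp only [Set.mem_preimage, cornerSimplex, Fin.forall_fin_succ, Fin.sum_univ_succ,
          MeasurableEquiv.piFinSuccAbove, Fin.insertNthEquiv, Set.mem_ofPred_eq] at hy
        simp at hy
        exact ht ⟨hy.1.1, by linarith [Finset.sum_nonneg fun k (_ : k ∈ Finset.univ) => hy.1.2 k]⟩
    simp_rw [hslice]
    rw [MeasureTheory.lintegral_indicator measurableSet_Icc,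
      ← MeasureTheory.ofReal_integral_eq_lintegral_ofReal]
    · congr 1
      rw [MeasureTheory.integral_Icc_eq_integral_Ioc, ← intervalIntegral.integral_of_le hr,
        intervalIntegral.integral_div, intervalIntegral.integral_comp_sub_left (fun t => t ^ n) r]
      rw [integral_pow, Nat.factorial_succ]
      push_cast
      field_simp
      simp
    · exact (Continuous.continuousOn (by fun_prop)).integrableOn_compact isCompact_Icc
    · refine (MeasureTheory.ae_restrict_iff' measurableSet_Icc).2 (.of_forall fun t ht => ?_)
      have : 0 ≤ r - t := by linarith [ht.2]
      show 0 ≤ (r - t) ^ n / _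
      positivity

lemma cornerSimplex_one_eq_convexHull (n : ℕ) :
    cornerSimplex n 1 = convexHull ℝ (insert 0 (Set.range fun k : Fin n => Pi.single k 1)) := by
  apply subset_antisymm
  · rintro x ⟨hx0, hx1⟩
    have hx : x = ∑ k : Option (Fin n), (k.elim (1 - ∑ k, x k) x) •
        (k.elim 0 fun k => Pi.single k 1 : Fin n → ℝ) := by
      rw [Fintype.sum_option]
      ext m
      simp [Finset.sum_apply, Pi.single_apply]
    rw [hx]
    refine (convex_convexHull ℝ _).sum_mem ?_ ?_ ?_
    · rintro (_ | k) -
      · simpa using hx1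
      · exact hx0 k
    · simp [Fintype.sum_option]
    · rintro (_ | k) -
      · exact subset_convexHull _ _ (by simp)
      · exact subset_convexHull _ _ (by simp)
  · refine convexHull_min ?_ ?_
    · rintro x (rfl | ⟨k, rfl⟩)
      · simp [cornerSimplex]
      · refine ⟨fun m => ?_, by simp⟩
        by_cases h : m = k <;> simp [h]
    · rintro x ⟨hx0, hx1⟩ y ⟨hy0, hy1⟩ a b ha hb hab
      refine ⟨fun k => ?_, ?_⟩
      · have := hx0 k
        have := hy0 k
        simp only [Pi.add_apply, Pi.smul_apply, smul_eq_mul]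
        positivity
      · simp only [Pi.add_apply, Pi.smul_apply, smul_eq_mul, Finset.sum_add_distrib,
          ← Finset.mul_sum]
        nlinarith

/-! ### Faces of convex hulls and regular subdivisions -/

/-- A face of a convex hull is spanned by the generators it contains. -/
lemma mem_convexHull_setOf_eq {E : Type*} [AddCommGroup E] [Module ℝ E] {V : Set E}
    (g : E →ₗ[ℝ] ℝ) {m : ℝ} (hm : ∀ a ∈ V, m ≤ g a) {x : E} (hx : x ∈ convexHull ℝ V)
    (hgx : g x = m) : x ∈ convexHull ℝ {a ∈ V | g a = m} := by
  have key : convexHull ℝ V ⊆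
      {x | m ≤ g x ∧ (g x = m → x ∈ convexHull ℝ {a ∈ V | g a = m})} := by
    refine convexHull_min (fun a ha => ⟨hm a ha, fun h => subset_convexHull _ _ ⟨ha, h⟩⟩) ?_
    refine convex_iff_forall_pos.2 ?_
    rintro x ⟨hx, hx'⟩ y ⟨hy, hy'⟩ a b ha hb hab
    have hg : g (a • x + b • y) = a * g x + b * g y := by simp
    have ha' : 0 ≤ a * (g x - m) := mul_nonneg ha.le (sub_nonneg.2 hx)
    have hb' : 0 ≤ b * (g y - m) := mul_nonneg hb.le (sub_nonneg.2 hy)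
    have hsum : g (a • x + b • y) - m = a * (g x - m) + b * (g y - m) := by
      rw [hg]
      linear_combination m * hab
    refine ⟨by linarith, fun h => ?_⟩
    · have h1 : a * (g x - m) = 0 := by linarith
      have h2 : b * (g y - m) = 0 := by linarith
      rw [mul_eq_zero_iff_left ha.ne', sub_eq_zero] at h1
      rw [mul_eq_zero_iff_left hb.ne', sub_eq_zero] at h2
      exact convex_convexHull ℝ _ (hx' h1) (hy' h2) ha.le hb.le hab
  exact (key hx).2 hgx

lemma setOf_minimal_convexHull {E : Type*} [AddCommGroup E] [Module ℝ E] (V : Set E)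
    (g : E →ₗ[ℝ] ℝ) :
    {x ∈ convexHull ℝ V | ∀ y ∈ convexHull ℝ V, g x ≤ g y} =
      convexHull ℝ {x ∈ V | ∀ y ∈ V, g x ≤ g y} := by
  apply subset_antisymm
  · rintro x ⟨hx, hmin⟩
    refine convexHull_mono ?_
      (mem_convexHull_setOf_eq g (fun a ha => hmin a (subset_convexHull _ _ ha)) hx rfl)
    rintro a ⟨ha, hax⟩
    exact ⟨ha, fun y hy => hax ▸ hmin y (subset_convexHull _ _ hy)⟩
  · refine convexHull_min ?_ ?_
    · rintro x ⟨hx, hmin⟩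
      exact ⟨subset_convexHull _ _ hx, fun y hy =>
        convexHull_min (t := {y | g x ≤ g y}) hmin (convex_halfSpace_ge g.isLinear _) hy⟩
    · rintro x ⟨hx, hxm⟩ y ⟨hy, hym⟩ a b ha hb hab
      refine ⟨convex_convexHull ℝ _ hx hy ha hb hab, fun z hz => ?_⟩
      simp only [map_add, map_smul, smul_eq_mul]
      calc a * g x + b * g y ≤ a * g z + b * g z := by gcongr <;> [exact hxm z hz; exact hym z hz]
        _ = g z := by rw [← add_mul, hab, one_mul]

lemma dim_convexHull {E : Type*} [AddCommGroup E] [Module ℝ E] (V : Set E) :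
    dim (convexHull ℝ V) = dim V := by
  rw [dim, dim, ← direction_affineSpan, affineSpan_convexHull, direction_affineSpan]

/-- A set in a non-vertical hyperplane has the dimension of its projection. -/
lemma dim_image_fst {n : ℕ} (F : Set ((Fin n → ℝ) × ℝ)) (c : Fin n → ℝ) {t m : ℝ} (ht : t ≠ 0)
    (hF : ∀ p ∈ F, c ⬝ᵥ p.1 + t * p.2 = m) : dim (Prod.fst '' F) = dim F := by
  let φ : (Fin n → ℝ) →ₗ[ℝ] (Fin n → ℝ) × ℝ :=
    LinearMap.prod LinearMap.id (-(t⁻¹ • dotProductBilin ℝ ℝ c))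
  let ψ : (Fin n → ℝ) →ᵃ[ℝ] (Fin n → ℝ) × ℝ :=
    φ.toAffineMap + AffineMap.const ℝ _ (0, m / t)
  have hψ : F = ψ '' (Prod.fst '' F) := by
    rw [Set.image_image]
    conv_lhs => rw [← Set.image_id F]
    refine Set.image_congr fun p hp => ?_
    have := hF p hp
    ext
    · simp [ψ, φ]
    · simp [ψ, φ]
      field_simp
      linarith
  have hlin : ψ.linear = φ := by simp [ψ]
  have hinj : Function.Injective φ := fun x y h => congrArg Prod.fst h
  conv_rhs => rw [hψ]
  rw [dim, dim, ← AffineMap.map_vectorSpan, hlin]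
  exact (Submodule.equivMapOfInjective φ hinj _).finrank_eq

/-- The points of `S` whose lifts lie on the lower supporting hyperplane with slope `c` of the
lifted polytope. -/
def tightPoints {n : ℕ} (S : Set (Fin n → ℝ)) (w : S → ℝ) (c : Fin n → ℝ) : Set (Fin n → ℝ) :=
  {x | ∃ a : S, (a : Fin n → ℝ) = x ∧ ∀ b : S, w a - c ⬝ᵥ a ≤ w b - c ⬝ᵥ b}

lemma mem_regularSubdivision_iff {n : ℕ} (S : Set (Fin n → ℝ)) (w : S → ℝ)
    (T : Set (Fin n → ℝ)) :
    T ∈ regularSubdivision S w ↔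
      ∃ c, T = convexHull ℝ (tightPoints S w c) ∧ dim T = n := by
  have face : ∀ (c : Fin n → ℝ) (t : ℝ), 0 < t → ∀ F,
      F = {p ∈ liftedPolytope S w | ∀ q ∈ liftedPolytope S w,
        c ⬝ᵥ p.1 + t * p.2 ≤ c ⬝ᵥ q.1 + t * q.2} →
      Prod.fst '' F = convexHull ℝ (tightPoints S w (-(t⁻¹ • c))) ∧
        dim (Prod.fst '' F) = dim F := by
    rintro c t ht F rfl
    refine ⟨?_, ?_⟩
    · let g : (Fin n → ℝ) × ℝ →ₗ[ℝ] ℝ :=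
        LinearMap.coprod (dotProductBilin ℝ ℝ c) (t • LinearMap.id)
      have := setOf_minimal_convexHull (Set.range fun a : S => ((a : Fin n → ℝ), w a)) g
      simp only [g, LinearMap.coprod_apply, dotProductBilin_apply_apply, LinearMap.smul_apply,
        LinearMap.id_apply, smul_eq_mul] at this
      rw [liftedPolytope, this]
      have himg := LinearMap.image_convexHull (LinearMap.fst ℝ (Fin n → ℝ) ℝ)
        {x ∈ Set.range fun a : S => ((a : Fin n → ℝ), w a) |
          ∀ y ∈ Set.range fun a : S => ((a : Fin n → ℝ), w a),
            c ⬝ᵥ x.1 + t * x.2 ≤ c ⬝ᵥ y.1 + t * y.2}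
      rw [LinearMap.coe_fst] at himg
      rw [himg]
      congr 1
      have hiff : ∀ a b : S, c ⬝ᵥ (a : Fin n → ℝ) + t * w a ≤ c ⬝ᵥ (b : Fin n → ℝ) + t * w b ↔
          w a - -(t⁻¹ • c) ⬝ᵥ (a : Fin n → ℝ) ≤ w b - -(t⁻¹ • c) ⬝ᵥ (b : Fin n → ℝ) := by
        intro a b
        rw [← mul_le_mul_iff_right₀ ht (b := w a - _)]
        simp only [neg_dotProduct, smul_dotProduct, smul_eq_mul, sub_neg_eq_add, mul_add,
          mul_inv_cancel_left₀ ht.ne']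
        rw [add_comm (c ⬝ᵥ _), add_comm (c ⬝ᵥ _)]
      ext x
      constructor
      · rintro ⟨p, ⟨⟨a, rfl⟩, ha⟩, rfl⟩
        exact ⟨a, rfl, fun b => (hiff a b).1 (ha _ ⟨b, rfl⟩)⟩
      · rintro ⟨a, rfl, ha⟩
        refine ⟨_, ⟨⟨a, rfl⟩, ?_⟩, rfl⟩
        rintro _ ⟨b, rfl⟩
        exact (hiff a b).2 (ha b)
    · obtain h | ⟨p, hp⟩ := Set.eq_empty_or_nonempty {p ∈ liftedPolytope S w |
        ∀ q ∈ liftedPolytope S w, c ⬝ᵥ p.1 + t * p.2 ≤ c ⬝ᵥ q.1 + t * q.2}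
      · rw [h, Set.image_empty, dim, dim, vectorSpan_empty, vectorSpan_empty, finrank_bot, finrank_bot]
      · exact dim_image_fst _ c ht.ne' fun q hq => le_antisymm (hq.2 p hp.1) (hp.2 q hq.1)
  constructor
  · rintro ⟨F, ⟨hdim, c, t, ht, hF⟩, rfl⟩
    obtain ⟨h1, h2⟩ := face c t ht F hF
    exact ⟨_, h1, h2.trans hdim⟩
  · rintro ⟨c, hT, hdim⟩
    obtain ⟨h1, h2⟩ := face (-c) 1 one_pos _ rfl
    simp only [inv_one, one_smul, neg_neg] at h1
    rw [← hT] at h1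
    exact ⟨_, ⟨by rw [← h2, h1, hdim], -c, 1, one_pos, rfl⟩, h1.symm⟩

/-! ### The edge vectors of the cycle -/

/-- The vector `e_{i} - e_{i+1}` along the edge `{i, i + 1}` of the cycle; the last one is
`e_n - e_{n+1} = e_n - e_0`. -/
def edgeVec (n : ℕ) (i : Fin (n + 1)) : Fin n → ℝ :=
  e n (i : ℕ) - e n ((i : ℕ) + 1)

lemma edgeVec_apply {n : ℕ} (i : Fin (n + 1)) (k : Fin n) :
    edgeVec n i k = (if i = k.succ then 1 else 0) - (if i = k.castSucc then 1 else 0) := by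
  simp [edgeVec, e, Fin.ext_iff, eq_comm]

lemma sum_smul_edgeVec_apply {n : ℕ} (x : Fin (n + 1) → ℝ) (k : Fin n) :
    (∑ i, x i • edgeVec n i) k = x k.succ - x k.castSucc := by
  simp [Finset.sum_apply, edgeVec_apply, mul_sub, Finset.sum_sub_distrib]

lemma sum_smul_edgeVec_eq_zero {n : ℕ} {x : Fin (n + 1) → ℝ} (h : ∑ i, x i • edgeVec n i = 0)
    (i : Fin (n + 1)) : x i = x 0 := by
  induction i using Fin.induction with
  | zero => rfl
  | succ k ih =>
    have := congrFun h k
    rw [sum_smul_edgeVec_apply] at this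
    simpa [← ih, sub_eq_zero] using this

lemma sum_edgeVec (n : ℕ) : ∑ i, edgeVec n i = 0 := by
  ext k
  simpa using sum_smul_edgeVec_apply (fun _ : Fin (n + 1) => (1 : ℝ)) k

/-- Three or more edge vectors are pairwise non-parallel: their only linear relation has all
coefficients equal, so it is trivial as soon as one coefficient vanishes. -/
lemma smul_edgeVec_injective {n : ℕ} (hn : 2 ≤ n) {i j : Fin (n + 1)} {s t : ℝ} (hs : s ≠ 0)
    (h : s • edgeVec n i = t • edgeVec n j) : i = j ∧ s = t := by
  have hrel : ∑ k, (Pi.single i s - Pi.single j t : Fin (n + 1) → ℝ) k • edgeVec n k = 0 := by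
    simp [sub_smul, Finset.sum_sub_distrib, Pi.single_apply, ite_smul, h]
  have hconst := sum_smul_edgeVec_eq_zero hrel
  obtain ⟨k, hk⟩ : ∃ k, k ∉ ({i, j} : Finset (Fin (n + 1))) := by
    by_contra! hall
    have h1 := Finset.card_le_card (fun k _ => hall k : Finset.univ ⊆ _)
    have h2 := Finset.card_le_two (a := i) (b := j)
    simp at h1
    omega
  simp only [Finset.mem_insert, Finset.mem_singleton, not_or] at hk
  have h0 : (Pi.single i s - Pi.single j t : Fin (n + 1) → ℝ) 0 = 0 := by
    rw [← hconst k]; simp [hk.1, hk.2]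
  have hi := hconst i
  rw [h0] at hi
  by_cases hij : i = j
  · subst hij
    exact ⟨rfl, by simpa [sub_eq_zero] using hi⟩
  · simp [hij, hs] at hi

lemma edgeVec_ne_zero {n : ℕ} (hn : 2 ≤ n) (i : Fin (n + 1)) : edgeVec n i ≠ 0 := by
  intro h
  have := smul_edgeVec_injective hn (i := i) (j := i) (s := 1) (t := 2) one_ne_zero (by simp [h])
  norm_num at this

lemma exists_sub_castSucc_eq {R : Type*} [AddCommGroup R] {n : ℕ} (y : Fin n → R) :
    ∃ x : Fin (n + 1) → R, ∀ k : Fin n, x k.succ - x k.castSucc = y k := by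
  refine ⟨fun j => ∑ k : Fin n, if (k : ℕ) < j then y k else 0, fun k => ?_⟩
  rw [← Finset.sum_sub_distrib, Finset.sum_eq_single k]
  · simp
  · intro b _ hb
    have : (b : ℕ) < k + 1 ↔ (b : ℕ) < k := by
      have := Fin.val_ne_of_ne hb
      omega
    simp [this]
  · simp

lemma mem_support_cycleGraph {n : ℕ} (hn : 2 ≤ n) (x : Fin n → ℝ) :
    x ∈ support (SimpleGraph.cycleGraph (n + 1)) ↔
      x = 0 ∨ ∃ (i : Fin (n + 1)) (s : ℤ), (s = -1 ∨ s = 1) ∧ x = (s : ℝ) • edgeVec n i := by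
  -- The successor of a node, the last node being followed by node `0`, for which `e 0 = e (n+1)`.
  have he : ∀ i : Fin (n + 1), e n ((i + 1 : Fin (n + 1)) : ℕ) = e n (i + 1) := by
    intro i
    rw [Fin.val_add_one]
    split_ifs with h
    · subst h
      ext k
      simp [e, k.2.ne]
    · rfl
  obtain ⟨m, rfl⟩ : ∃ m, n = m + 1 := ⟨n - 1, by omega⟩
  simp only [support, Set.singleton_union, Set.mem_insert_iff, Set.mem_ofPred_eq]
  refine or_congr_right ⟨?_, ?_⟩
  · rintro ⟨i, j, hij, rfl⟩
    rcases SimpleGraph.cycleGraph_adj.1 hij with h | h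
    · obtain rfl : i = j + 1 := by rw [← h]; abel
      exact ⟨j, -1, by simp, by simp [edgeVec, he]⟩
    · obtain rfl : j = i + 1 := by rw [← h]; abel
      exact ⟨i, 1, by simp, by simp [edgeVec, he]⟩
  · rintro ⟨i, s, rfl | rfl, rfl⟩
    · exact ⟨i + 1, i, SimpleGraph.cycleGraph_adj.2 (by simp), by simp [edgeVec, he]⟩
    · exact ⟨i, i + 1, SimpleGraph.cycleGraph_adj.2 (by simp), by simp [edgeVec, he]⟩

/-- The height of the two points `± edgeVec n i`. -/
def weight {n : ℕ} (i : Fin (n + 1)) : ℤ := if i = 0 then 2 else 1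

lemma weight_pos {n : ℕ} (i : Fin (n + 1)) : 0 < weight i := by
  unfold weight; split_ifs <;> norm_num

lemma height_zero {n : ℕ} {S : Set (Fin n → ℝ)} (a : S) (ha : (a : Fin n → ℝ) = 0) :
    height a = 0 := by
  simp [height, ha]

lemma height_smul_edgeVec {n : ℕ} (hn : 2 ≤ n) {S : Set (Fin n → ℝ)} (a : S) {s : ℤ}
    (hs : s = -1 ∨ s = 1) {i : Fin (n + 1)} (ha : (a : Fin n → ℝ) = (s : ℝ) • edgeVec n i) :
    height a = weight i := by
  have h0 : edgeVec n 0 = -e n 1 := by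
    ext k; simp [edgeVec, e]
  have hs0 : (s : ℝ) ≠ 0 := by rcases hs with rfl | rfl <;> norm_num
  have h1 : (a : Fin n → ℝ) ≠ 0 := by
    rw [ha]; exact smul_ne_zero hs0 (edgeVec_ne_zero hn i)
  have h2 : ((a : Fin n → ℝ) = e n 1 ∨ (a : Fin n → ℝ) = -e n 1) ↔ i = 0 := by
    constructor
    · rintro (h | h)
      · refine (smul_edgeVec_injective hn (t := -1) hs0 ?_).1
        rw [← ha, h, h0]; simp
      · refine (smul_edgeVec_injective hn (t := 1) hs0 ?_).1
        rw [← ha, h, h0]; simp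
    · rintro rfl
      rw [ha, h0]
      rcases hs with rfl | rfl <;> simp
  simp only [height, h1, if_false, h2, weight]

/-! ### The cells are unimodular simplices -/

/-- The vertices of the cell of `l` that omits `v l i`. -/
def cellVertices {n : ℕ} (l : Fin (n + 1) → ℤ) (i : Fin (n + 1)) : Set (Fin n → ℝ) :=
  pyramidVertices l \ {v l i}

lemma v_eq {n : ℕ} (l : Fin (n + 1) → ℤ) (i : Fin (n + 1)) :
    v l i = (l i : ℝ) • edgeVec n i := rfl

/-- The condition `l ∈ {-1, 1}^N`. -/
def IsSign {n : ℕ} (l : Fin (n + 1) → ℤ) : Prop := ∀ i, l i = -1 ∨ l i = 1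

lemma IsSign.ne_zero {n : ℕ} {l : Fin (n + 1) → ℤ} (hl : IsSign l) (i : Fin (n + 1)) :
    (l i : ℝ) ≠ 0 := by
  rcases hl i with h | h <;> simp [h]

lemma IsSign.mul_self {n : ℕ} {l : Fin (n + 1) → ℤ} (hl : IsSign l) (i : Fin (n + 1)) :
    l i * l i = 1 := by
  rcases hl i with h | h <;> simp [h]

lemma cellVertices_eq {n : ℕ} (hn : 2 ≤ n) {l : Fin (n + 1) → ℤ} (hl : IsSign l)
    (i : Fin (n + 1)) :
    cellVertices l i = insert 0 (Set.range fun k : Fin n => v l (i.succAbove k)) := by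
  ext x
  simp only [cellVertices, pyramidVertices, Set.singleton_union, Set.mem_sdiff, Set.mem_insert_iff,
    Set.mem_range, Set.mem_singleton_iff]
  constructor
  · rintro ⟨rfl | ⟨j, rfl⟩, hx⟩
    · exact Or.inl rfl
    · obtain ⟨k, rfl⟩ := Fin.exists_succAbove_eq (x := j) (y := i) (by rintro rfl; exact hx rfl)
      exact Or.inr ⟨k, rfl⟩
  · rintro (rfl | ⟨k, rfl⟩)
    · exact ⟨Or.inl rfl, (smul_ne_zero (hl.ne_zero i) (edgeVec_ne_zero hn i)).symm⟩
    · exact ⟨Or.inr ⟨_, rfl⟩, fun h =>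
        Fin.succAbove_ne i k (smul_edgeVec_injective hn (hl.ne_zero _) h).1⟩

/-- The matrix whose columns are the nonzero vertices of a cell. -/
def cellMatrix {n : ℕ} (l : Fin (n + 1) → ℤ) (i : Fin (n + 1)) : Matrix (Fin n) (Fin n) ℤ :=
  Matrix.of fun k m => l (i.succAbove m) *
    ((if i.succAbove m = k.succ then 1 else 0) - (if i.succAbove m = k.castSucc then 1 else 0))

/-- The nonzero vertices of a cell span the lattice: an integer vector is an integer combination
of all `n + 1` edge vectors (by summation of its coordinates), and the edge vector missing from the
cell is the negative of the sum of the others. -/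
lemma isUnit_cellMatrix {n : ℕ} {l : Fin (n + 1) → ℤ} (hl : IsSign l) (i : Fin (n + 1)) :
    IsUnit (cellMatrix l i) := by
  rw [← Matrix.mulVec_surjective_iff_isUnit]
  intro y
  obtain ⟨x, hx⟩ := exists_sub_castSucc_eq y
  refine ⟨fun m => l (i.succAbove m) * (x (i.succAbove m) - x i), ?_⟩
  ext k
  have hsum : ∑ j, (x j - x i) * ((if j = k.succ then 1 else 0) -
      (if j = k.castSucc then 1 else 0)) = y k := by
    simp [mul_sub, Finset.sum_sub_distrib, ← hx k]
  rw [Fin.sum_univ_succAbove _ i, sub_self, zero_mul, zero_add] at hsum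
  rw [← hsum, Matrix.mulVec, dotProduct]
  refine Finset.sum_congr rfl fun m _ => ?_
  rw [cellMatrix, Matrix.of_apply]
  linear_combination ((x (i.succAbove m) - x i) * ((if i.succAbove m = k.succ then 1 else 0) -
    (if i.succAbove m = k.castSucc then 1 else 0))) * hl.mul_self (i.succAbove m)

/-- The linear map taking the standard basis to the nonzero vertices of a cell. -/
noncomputable def cellMap {n : ℕ} (l : Fin (n + 1) → ℤ) (i : Fin (n + 1)) :
    (Fin n → ℝ) →ₗ[ℝ] (Fin n → ℝ) :=
  Matrix.toLin' ((cellMatrix l i).map (Int.cast : ℤ → ℝ))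

lemma cellMap_single {n : ℕ} (l : Fin (n + 1) → ℤ) (i : Fin (n + 1)) (m : Fin n) :
    cellMap l i (Pi.single m 1) = v l (i.succAbove m) := by
  ext k
  simp [cellMap, cellMatrix, v_eq, edgeVec_apply]

lemma cellMap_apply {n : ℕ} (l : Fin (n + 1) → ℤ) (i : Fin (n + 1)) (u : Fin n → ℝ) :
    cellMap l i u = ∑ m, u m • v l (i.succAbove m) := by
  conv_lhs => rw [← (Pi.basisFun ℝ (Fin n)).sum_repr u]
  simp [map_sum, cellMap_single]

lemma abs_det_cellMap {n : ℕ} {l : Fin (n + 1) → ℤ} (hl : IsSign l) (i : Fin (n + 1)) :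
    |LinearMap.det (cellMap l i)| = 1 := by
  have h := (Matrix.isUnit_iff_isUnit_det _).1 (isUnit_cellMatrix hl i)
  have hdet : LinearMap.det (cellMap l i) = ((cellMatrix l i).det : ℝ) := by
    rw [cellMap, LinearMap.det_toLin']
    exact (RingHom.map_det (Int.castRingHom ℝ) _).symm
  rw [hdet, ← Int.cast_abs, Int.isUnit_iff_abs_eq.1 h, Int.cast_one]

lemma cell_eq_image {n : ℕ} (hn : 2 ≤ n) {l : Fin (n + 1) → ℤ} (hl : IsSign l)
    (i : Fin (n + 1)) :
    convexHull ℝ (cellVertices l i) = cellMap l i '' cornerSimplex n 1 := by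
  rw [cornerSimplex_one_eq_convexHull, LinearMap.image_convexHull, Set.image_insert_eq, map_zero,
    ← Set.range_comp, cellVertices_eq hn hl]
  congr 3
  exact funext fun m => (cellMap_single l i m).symm

lemma normalizedVolume_cell {n : ℕ} (hn : 2 ≤ n) {l : Fin (n + 1) → ℤ} (hl : IsSign l)
    (i : Fin (n + 1)) : normalizedVolume (convexHull ℝ (cellVertices l i)) = 1 := by
  rw [normalizedVolume, cell_eq_image hn hl, MeasureTheory.Measure.addHaar_image_linearMap,
    abs_det_cellMap hl, volume_cornerSimplex n 1 zero_le_one, ENNReal.ofReal_one, one_mul, one_pow,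
    ← ENNReal.ofReal_natCast, ← ENNReal.ofReal_mul (by positivity),
    mul_one_div_cancel (by positivity), ENNReal.ofReal_one]

lemma linearIndependent_v {n : ℕ} {l : Fin (n + 1) → ℤ} (hl : IsSign l) (i : Fin (n + 1)) :
    LinearIndependent ℝ fun m => v l (i.succAbove m) := by
  have hinj : LinearMap.ker (cellMap l i) = ⊥ := by
    refine LinearMap.ker_eq_bot_of_injective ?_
    have hd : LinearMap.det (cellMap l i) ≠ 0 := by
      intro h
      simpa [h] using abs_det_cellMap hl i
    exact (LinearMap.equivOfDetNeZero _ hd).injective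
  have := (Pi.basisFun ℝ (Fin n)).linearIndependent.map' _ hinj
  have hcol : (fun m => v l (i.succAbove m)) = cellMap l i ∘ Pi.basisFun ℝ (Fin n) :=
    funext fun m => by simp [cellMap_single]
  rw [hcol]
  exact this

lemma affineIndependent_cellVertices {n : ℕ} (hn : 2 ≤ n) {l : Fin (n + 1) → ℤ} (hl : IsSign l)
    (i : Fin (n + 1)) :
    AffineIndependent ℝ ((↑) : cellVertices l i → Fin n → ℝ) := by
  have h := (linearIndependent_v hl i).linearIndepOn_id
  have h0 : ∀ x ∈ Set.range fun m => v l (i.succAbove m), x ≠ 0 := by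
    rintro _ ⟨m, rfl⟩
    exact (linearIndependent_v hl i).ne_zero m
  have := (linearIndependent_set_iff_affineIndependent_vadd_union_singleton ℝ h0
    (0 : Fin n → ℝ)).1 h
  rw [cellVertices_eq hn hl]
  have himg : ∀ A : Set (Fin n → ℝ), (fun x => x +ᵥ (0 : Fin n → ℝ)) '' A = A := fun A =>
    (Set.image_congr fun x _ => add_zero x).trans (Set.image_id' A)
  rwa [himg, Set.singleton_union] at this

lemma dim_cell {n : ℕ} (hn : 2 ≤ n) {l : Fin (n + 1) → ℤ} (hl : IsSign l) (i : Fin (n + 1)) :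
    dim (convexHull ℝ (cellVertices l i)) = n := by
  rw [dim_convexHull, dim, vectorSpan_eq_span_vsub_set_right ℝ (p := (0 : Fin n → ℝ))
    (by rw [cellVertices_eq hn hl]; simp)]
  have himg : ∀ A : Set (Fin n → ℝ), (fun x => x -ᵥ (0 : Fin n → ℝ)) '' A = A := fun A =>
    (Set.image_congr fun x _ => sub_zero x).trans (Set.image_id' A)
  rw [himg, cellVertices_eq hn hl, Submodule.span_insert_zero,
    finrank_span_eq_card (linearIndependent_v hl i), Fintype.card_fin]

lemma cellVertices_subset_support {n : ℕ} (hn : 2 ≤ n) {l : Fin (n + 1) → ℤ} (hl : IsSign l)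
    (i : Fin (n + 1)) : cellVertices l i ⊆ support (SimpleGraph.cycleGraph (n + 1)) := by
  rw [cellVertices_eq hn hl]
  rintro x (rfl | ⟨m, rfl⟩)
  · exact (mem_support_cycleGraph hn _).2 (Or.inl rfl)
  · exact (mem_support_cycleGraph hn _).2 (Or.inr ⟨_, _, hl _, rfl⟩)

lemma support_subset_latticePoints {n : ℕ} (G : SimpleGraph (Fin (n + 1))) :
    support G ⊆ latticePoints n := by
  rintro x (rfl | ⟨i, j, -, rfl⟩) k
  · exact ⟨0, by simp⟩
  · exact ⟨(if (k : ℕ) + 1 = i then 1 else 0) - (if (k : ℕ) + 1 = j then 1 else 0), by simp [e]⟩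

/-! ### Certificates: the lower hyperplanes of the lifted polytope -/

/-- The heights on the support of the cycle graph, as real numbers. -/
noncomputable abbrev cycleHeight (n : ℕ) (a : support (SimpleGraph.cycleGraph (n + 1))) : ℝ :=
  ((height a : ℤ) : ℝ)

/-- The linear functional `c` agrees with the heights at the vertices of the cell given by `l` and
`i`, and lies strictly below them at the remaining points of the support. -/
structure IsCertificate {n : ℕ} (c : Fin n → ℝ) (l : Fin (n + 1) → ℤ) (i : Fin (n + 1)) : Prop where
  eq : ∀ j, j ≠ i → c ⬝ᵥ edgeVec n j = l j * weight j
  lt : |c ⬝ᵥ edgeVec n i| < weight i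

lemma sum_dotProduct_edgeVec {n : ℕ} (c : Fin n → ℝ) : ∑ j, c ⬝ᵥ edgeVec n j = 0 := by
  rw [← dotProduct_sum, sum_edgeVec, dotProduct_zero]

/-- The edge vectors satisfy only the relation `∑ j, edgeVec n j = 0`, so the values of a linear
functional on them may be any numbers with sum zero; its coordinates are the negated partial sums
of these. -/
lemma exists_dotProduct_edgeVec_eq {n : ℕ} (y : Fin (n + 1) → ℝ) (hy : ∑ j, y j = 0) :
    ∃ c : Fin n → ℝ, ∀ j, c ⬝ᵥ edgeVec n j = y j := by
  let Y : ℕ → ℝ := fun m => ∑ j : Fin (n + 1), if (j : ℕ) < m then y j else 0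
  have hY0 : Y 0 = 0 := by simp [Y]
  have hYn : Y (n + 1) = 0 := (Finset.sum_congr rfl fun j _ => if_pos j.2).trans hy
  have hstep : ∀ j : Fin (n + 1), Y (j + 1) - Y j = y j := by
    intro j
    simp only [Y]
    rw [← Finset.sum_sub_distrib, Finset.sum_eq_single j]
    · simp
    · intro b _ hb
      have : (b : ℕ) < j + 1 ↔ (b : ℕ) < j := by
        have := Fin.val_ne_of_ne hb
        omega
      simp [this]
    · simp
  let c : Fin n → ℝ := fun k => -Y (k + 1)
  have hce : ∀ m ≤ n + 1, c ⬝ᵥ e n m = -Y m := by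
    intro m hm
    by_cases h : ∃ k : Fin n, (k : ℕ) + 1 = m
    · obtain ⟨k, rfl⟩ := h
      rw [dotProduct, Finset.sum_eq_single k]
      · simp [c, e]
      · intro b _ hb
        simp [e, Fin.val_ne_of_ne hb]
      · simp
    · have h0 : c ⬝ᵥ e n m = 0 := by
        refine Finset.sum_eq_zero fun k _ => ?_
        have : (k : ℕ) + 1 ≠ m := fun hk => h ⟨k, hk⟩
        simp [e, this]
      have hm' : m = 0 ∨ m = n + 1 := by
        by_contra! hne
        exact h ⟨⟨m - 1, by omega⟩, by simp; omega⟩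
      rcases hm' with rfl | rfl
      · rw [h0, hY0, neg_zero]
      · rw [h0, hYn, neg_zero]
  refine ⟨c, fun j => ?_⟩
  rw [edgeVec, dotProduct_sub, hce _ (by omega), hce _ (by omega), ← hstep j]
  ring

lemma sum_mul_weight {n : ℕ} (l : Fin (n + 1) → ℤ) :
    ∑ j, l j * weight j = l 0 + ∑ j, l j := by
  have : ∀ j : Fin (n + 1), l j * weight j = (if j = 0 then l 0 else 0) + l j := by
    intro j
    by_cases h : j = 0
    · subst h; simp [weight]; ring
    · simp [weight, h]
  simp [this, Finset.sum_add_distrib]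

/-- The functional exists because the values at all edge vectors but the `i`-th may be prescribed,
and then the `i`-th value is `λᵢ wᵢ - λ₀`, which is `λ₀` if `i = 0` and `0` otherwise. -/
lemma exists_isCertificate {n : ℕ} {l : Fin (n + 1) → ℤ} (hl : l ∈ Lam n) {i : Fin (n + 1)}
    (hi : l i = l 0) : ∃ c : Fin n → ℝ, IsCertificate c l i := by
  obtain ⟨c, hc⟩ := exists_dotProduct_edgeVec_eq
    (fun j => (((l j * weight j - if j = i then l 0 else 0 : ℤ)) : ℝ)) (by
      rw [← Int.cast_sum, Finset.sum_sub_distrib, sum_mul_weight, hl.2]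
      simp)
  refine ⟨c, fun j hj => ?_, ?_⟩
  · rw [hc]; simp [hj]
  · rw [hc, ← Int.cast_abs, Int.cast_lt]
    simp only [if_true, hi]
    by_cases h : i = 0
    · rcases hl.1 0 with h1 | h1 <;> simp [weight, h, h1]
    · simp [weight, h]

lemma IsCertificate.le_and_eq_iff {n : ℕ} (hn : 2 ≤ n) {c : Fin n → ℝ} {l : Fin (n + 1) → ℤ}
    {i : Fin (n + 1)} (h : IsCertificate c l i) (hl : IsSign l)
    (a : support (SimpleGraph.cycleGraph (n + 1))) :
    c ⬝ᵥ (a : Fin n → ℝ) ≤ cycleHeight n a ∧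
      (c ⬝ᵥ (a : Fin n → ℝ) = cycleHeight n a ↔ (a : Fin n → ℝ) ∈ cellVertices l i) := by
  rw [cellVertices_eq hn hl]
  rcases (mem_support_cycleGraph hn _).1 a.2 with ha | ⟨j, s, hs, ha⟩
  · rw [cycleHeight, height_zero a ha, ha]
    simp
  · have hs0 : (s : ℝ) ≠ 0 := by rcases hs with rfl | rfl <;> norm_num
    rw [cycleHeight, height_smul_edgeVec hn a hs ha, ha, dotProduct_smul, smul_eq_mul]
    have hne : (s : ℝ) • edgeVec n j ≠ 0 := smul_ne_zero hs0 (edgeVec_ne_zero hn j)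
    have hmem : (s : ℝ) • edgeVec n j ∈
        insert 0 (Set.range fun k : Fin n => v l (i.succAbove k)) ↔ j ≠ i ∧ s = l j := by
      simp only [Set.mem_insert_iff, hne, false_or, Set.mem_range]
      constructor
      · rintro ⟨k, hk⟩
        obtain ⟨rfl, h2⟩ := smul_edgeVec_injective hn (hl.ne_zero _) hk
        exact ⟨Fin.succAbove_ne i k, by exact_mod_cast h2.symm⟩
      · rintro ⟨hj, rfl⟩
        obtain ⟨k, rfl⟩ := Fin.exists_succAbove_eq hj
        exact ⟨k, rfl⟩
    rw [hmem]
    have hw : (0 : ℝ) < weight j := by exact_mod_cast weight_pos j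
    by_cases hj : j = i
    · subst hj
      have := abs_lt.1 h.lt
      have hlt : (s : ℝ) * (c ⬝ᵥ edgeVec n j) < weight j := by
        rcases hs with rfl | rfl <;> push_cast <;> linarith
      exact ⟨hlt.le, by simp [hlt.ne]⟩
    · rw [h.eq j hj]
      have hw' := weight_pos j
      rcases hs with rfl | rfl <;> rcases hl j with h' | h' <;> simp [h', hj] <;> grind

lemma IsCertificate.tightPoints_eq {n : ℕ} (hn : 2 ≤ n) {c : Fin n → ℝ} {l : Fin (n + 1) → ℤ}
    {i : Fin (n + 1)} (h : IsCertificate c l i) (hl : IsSign l) :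
    tightPoints _ (cycleHeight n) c = cellVertices l i := by
  have key := h.le_and_eq_iff hn hl
  ext x
  constructor
  · rintro ⟨a, rfl, ha⟩
    rw [← (key a).2]
    have h0 := ha ⟨0, (mem_support_cycleGraph hn _).2 (Or.inl rfl)⟩
    simp only [cycleHeight, height_zero, dotProduct_zero, Int.cast_zero, sub_zero] at h0
    linarith [(key a).1]
  · intro hx
    let a : support (SimpleGraph.cycleGraph (n + 1)) := ⟨x, cellVertices_subset_support hn hl i hx⟩
    refine ⟨a, rfl, fun b => ?_⟩
    have h1 := ((key a).2).2 hx
    linarith [(key b).1]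

/-- Every lower facet is given by a certificate. If the supporting hyperplane passes below the
origin, it touches the lift of one of `± edgeVec n j` for every `j`; if it passes through the
origin, this is so for all `j` but at most one. A parity argument excludes that it is so for all
`j`, and determines the value of the functional at the remaining edge vector. -/
lemma exists_isCertificate_of_dim {n : ℕ} (hn : 2 ≤ n) (hN : Even (n + 1)) (c : Fin n → ℝ)
    (hdim : dim (tightPoints _ (cycleHeight n) c) = n) :
    ∃ l ∈ Lam n, ∃ i, l i = l 0 ∧ IsCertificate c l i := by
  set A := tightPoints _ (cycleHeight n) c with hA
  have hmem0 := (mem_support_cycleGraph hn (0 : Fin n → ℝ)).2 (Or.inl rfl)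
  have hmem : ∀ (j : Fin (n + 1)) (s : ℤ), s = -1 ∨ s = 1 →
      (s : ℝ) • edgeVec n j ∈ support (SimpleGraph.cycleGraph (n + 1)) := fun j s hs =>
    (mem_support_cycleGraph hn _).2 (Or.inr ⟨j, s, hs, rfl⟩)
  let y : Fin (n + 1) → ℝ := fun j => c ⬝ᵥ edgeVec n j
  have hy : ∑ j, y j = 0 := sum_dotProduct_edgeVec c
  obtain ⟨x0, a0, rfl, ha0⟩ : A.Nonempty := by
    rw [Set.nonempty_iff_ne_empty]
    intro h
    rw [h, dim, vectorSpan_empty, finrank_bot] at hdim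
    omega
  obtain ⟨r, hr⟩ : ∃ r, r = -(cycleHeight n a0 - c ⬝ᵥ (a0 : Fin n → ℝ)) := ⟨_, rfl⟩
  have hr0 : 0 ≤ r := by
    have := ha0 ⟨0, hmem0⟩
    simp only [cycleHeight, height_zero, dotProduct_zero, Int.cast_zero, sub_zero] at this
    linarith
  have hyle : ∀ j, |y j| ≤ weight j + r := by
    intro j
    have h1 := ha0 ⟨_, hmem j 1 (by simp)⟩
    have h2 := ha0 ⟨_, hmem j (-1) (by simp)⟩
    rw [cycleHeight, cycleHeight, height_smul_edgeVec hn ⟨_, hmem j 1 (by simp)⟩ (Or.inr rfl) rfl,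
      dotProduct_smul] at h1
    rw [cycleHeight, cycleHeight, height_smul_edgeVec hn ⟨_, hmem j (-1) (by simp)⟩ (Or.inl rfl) rfl,
      dotProduct_smul] at h2
    rw [cycleHeight] at hr
    simp only [Int.cast_neg, Int.cast_one, smul_eq_mul] at h1 h2
    rw [abs_le]
    constructor <;> linarith
  -- A sign vector recording which of the two points `± edgeVec n j` can be tight.
  let σ : Fin (n + 1) → ℤ := fun j => if 0 < y j then 1 else -1
  have hσ : IsSign σ := fun j => by
    simp only [σ]; split_ifs <;> simp
  have hσy : ∀ j, |y j| = σ j * y j := by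
    intro j
    simp only [σ]
    split_ifs with h
    · simp [abs_of_pos h]
    · simp [abs_of_nonpos (not_lt.1 h)]
  classical
  let I : Finset (Fin (n + 1)) := Finset.univ.filter fun j => |y j| = weight j + r
  have hAsub : A ⊆ ((if r = 0 then {0} else ∅) ∪ I.image (v σ) : Finset (Fin n → ℝ)) := by
    rintro _ ⟨a, rfl, ha⟩
    have har : cycleHeight n a - c ⬝ᵥ (a : Fin n → ℝ) = -r := by
      rw [hr, neg_neg]
      exact le_antisymm (ha a0) (ha0 a)
    rw [cycleHeight] at har
    rw [Finset.mem_coe, Finset.mem_union]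
    rcases (mem_support_cycleGraph hn _).1 a.2 with ha | ⟨j, s, hs, ha⟩
    · left
      rw [height_zero a ha, ha] at har
      have : r = 0 := by simpa using har.symm
      simp [this, ha]
    · right
      rw [height_smul_edgeVec hn a hs ha, ha, dotProduct_smul, smul_eq_mul] at har
      have hw : (0 : ℝ) < weight j := by exact_mod_cast weight_pos j
      have hsy : (s : ℝ) * y j = weight j + r := by simp only [y]; linarith
      have hsσ : s = σ j := by
        rcases hs with rfl | rfl
        · have : ¬ 0 < y j := by push_cast at hsy; intro h; linarith
          simp [σ, this]
        · have : 0 < y j := by push_cast at hsy; linarith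
          simp [σ, this]
      refine Finset.mem_image.2 ⟨j, ?_, ?_⟩
      · simp only [I, Finset.mem_filter, Finset.mem_univ, true_and]
        rw [hσy, ← hsσ, hsy]
      · rw [ha, v_eq, hsσ]
  have hcard : n + 1 ≤ (if r = 0 then 1 else 0) + I.card := by
    obtain ⟨B, hB⟩ := (Finset.finite_toSet _).subset hAsub |>.exists_finset_coe
    have hBcard : n ≤ B.card - 1 := by
      have hne : B.Nonempty := by
        rw [← Finset.coe_nonempty, hB]
        exact ⟨_, a0, rfl, ha0⟩
      have := finrank_vectorSpan_image_finset_le ℝ (id : (Fin n → ℝ) → _) B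
        (n := B.card - 1) (by have := hne.card_pos; omega)
      rw [Finset.image_id, hB] at this
      exact hdim.symm.le.trans this
    have h1 : B.card ≤ _ := Finset.card_le_card (Finset.coe_subset.1 (hB ▸ hAsub))
    have h2 := Finset.card_union_le (if r = 0 then {0} else ∅) (I.image (v σ))
    have h3 : (I.image (v σ)).card ≤ I.card := Finset.card_image_le
    have h4 : (if r = 0 then {0} else ∅ : Finset (Fin n → ℝ)).card = if r = 0 then 1 else 0 := by
      split_ifs <;> simp
    omega
  have hI : ∀ j ∈ I, y j = σ j * (weight j + r) := by
    intro j hj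
    have : |y j| = weight j + r := by simpa [I] using hj
    rw [← this, hσy, ← mul_assoc, ← Int.cast_mul, hσ.mul_self]
    simp
  have hσeven : Even (∑ j, σ j) := by
    have : (∑ j, σ j : ℤ) ≡ ∑ j : Fin (n + 1), 1 [ZMOD 2] := by
      refine Int.ModEq.sum fun j _ => ?_
      rcases hσ j with h | h <;> simp [h, Int.ModEq]
    rw [Int.even_iff, this]
    simpa using Int.even_iff.1 (by exact_mod_cast hN : Even ((n : ℤ) + 1))
  have hIuniv : I ≠ Finset.univ := by
    intro h
    have hsum : (((σ 0 + ∑ j, σ j : ℤ)) : ℝ) + r * ((∑ j, σ j : ℤ) : ℝ) = 0 := by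
      rw [← sum_mul_weight, ← hy, Int.cast_sum, Int.cast_sum, Finset.mul_sum,
        ← Finset.sum_add_distrib]
      refine Finset.sum_congr rfl fun j _ => ?_
      rw [hI j (h ▸ Finset.mem_univ j)]
      push_cast
      ring
    obtain ⟨m, hm⟩ := hσeven
    rw [hm] at hsum
    push_cast at hsum
    -- `(1 + r) * (2 m) = ∓ 1` is impossible for an integer `m` and `r ≥ 0`.
    rcases lt_trichotomy m 0 with hm0 | rfl | hm0
    · have hm1 : (m : ℝ) ≤ -1 := by exact_mod_cast (by omega : m ≤ -1)
      rcases hσ 0 with h0 | h0 <;> rw [h0] at hsum <;> push_cast at hsum <;> nlinarith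
    · rcases hσ 0 with h0 | h0 <;> rw [h0] at hsum <;> norm_num at hsum
    · have hm1 : (1 : ℝ) ≤ m := by exact_mod_cast hm0
      rcases hσ 0 with h0 | h0 <;> rw [h0] at hsum <;> push_cast at hsum <;> nlinarith
  have hIlt : I.card < n + 1 := by
    simpa using Finset.card_lt_card (Finset.ssubset_univ_iff.2 hIuniv)
  have hr0 : r = 0 := by
    by_contra h
    rw [if_neg h] at hcard
    omega
  obtain ⟨i, hi⟩ : ∃ i, Iᶜ = {i} := by
    rw [← Finset.card_eq_one, Finset.card_compl, Fintype.card_fin]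
    rw [if_pos hr0] at hcard
    omega
  have hiI : i ∉ I := by
    rw [← Finset.mem_compl, hi]; exact Finset.mem_singleton_self i
  have hyj : ∀ j, j ≠ i → y j = σ j * weight j := by
    intro j hj
    have : j ∈ I := by
      by_contra h
      rw [← Finset.mem_compl, hi] at h
      exact hj (Finset.mem_singleton.1 h)
    rw [hI j this, hr0, add_zero]
  have hyi : |y i| < weight i := by
    refine lt_of_le_of_ne (by simpa [hr0] using hyle i) fun h => hiI ?_
    simp [I, h, hr0]
  let z : ℤ := -∑ j ∈ Finset.univ.erase i, σ j * weight j
  have hz : y i = z := by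
    rw [← Finset.add_sum_erase _ _ (Finset.mem_univ i), Finset.sum_congr rfl
      fun j hj => hyj j (Finset.ne_of_mem_erase hj)] at hy
    simp only [z]
    push_cast
    linarith
  have hzlt : |z| < weight i := by
    rw [hz] at hyi
    exact_mod_cast hyi
  -- All that is left is to choose the `i`-th sign `t`.
  suffices h : ∃ t : ℤ, (t = -1 ∨ t = 1) ∧ t * weight i - z = (if i = 0 then t else σ 0) ∧
      t = (if i = 0 then t else σ 0) by
    obtain ⟨t, ht, hsum, ht0⟩ := h
    have hl0 : Function.update σ i t 0 = if i = 0 then t else σ 0 := by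
      split_ifs with h
      · subst h; simp
      · rw [Function.update_of_ne (Ne.symm h)]
    have hw : ∑ j, Function.update σ i t j * weight j = t * weight i - z := by
      rw [← Finset.add_sum_erase _ _ (Finset.mem_univ i), Finset.sum_congr rfl
        fun j hj => by rw [Function.update_of_ne (Finset.ne_of_mem_erase hj)],
        Function.update_self]
      simp only [z, sub_neg_eq_add]
    rw [sum_mul_weight, hsum, hl0] at hw
    refine ⟨Function.update σ i t, ⟨fun j => ?_, by linarith⟩, i, ?_, ⟨fun j hj => ?_, hyi⟩⟩
    · by_cases hj : j = i
      · subst hj; simpa using ht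
      · simpa [hj] using hσ j
    · rw [hl0, ← ht0]; simp
    · rw [Function.update_of_ne hj]; exact hyj j hj
  by_cases hi0 : i = 0
  · subst hi0
    have hpar : σ 0 * 2 - z = σ 0 + ∑ j, σ j := by
      rw [← sum_mul_weight, ← Finset.add_sum_erase _ _ (Finset.mem_univ 0)]
      simp [z, weight]
    obtain ⟨m, hm⟩ := hσeven
    rw [abs_lt] at hzlt
    simp only [weight, if_true] at hzlt ⊢
    refine ⟨z, ?_, by ring, trivial⟩
    rcases hσ 0 with h | h <;> omega
  · rw [abs_lt] at hzlt
    simp only [weight, if_neg hi0] at hzlt ⊢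
    exact ⟨σ 0, hσ 0, by omega, rfl⟩

/-! ### The cells cover the polytope -/

lemma finite_Lam (n : ℕ) : (Lam n).Finite := by
  refine (Set.Finite.pi' (t := fun _ => {-1, 1}) fun _ : Fin (n + 1) => Set.toFinite _).subset ?_
  exact fun l hl i => hl.1 i

lemma nonempty_Lam {n : ℕ} (hN : Even (n + 1)) : (Lam n).Nonempty := by
  refine ⟨fun i => (-1) ^ (i : ℕ), fun i => ?_, ?_⟩
  · rcases neg_one_pow_eq_or ℤ (i : ℕ) with h | h <;> simp [h]
  · rw [Fin.sum_univ_eq_sum_range fun i => (-1 : ℤ) ^ i, neg_one_geom_sum, if_pos hN]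

/-- A balanced sign vector maximizing `∑ λⱼ xⱼ` separates the larger half of the `xⱼ` from the
smaller half: exchanging the signs of two indices does not increase the sum. -/
lemma exists_mem_Lam_forall_le {n : ℕ} (hN : Even (n + 1)) (x : Fin (n + 1) → ℝ) :
    ∃ l ∈ Lam n, ∀ j k, l j = 1 → l k = -1 → x k ≤ x j := by
  obtain ⟨l, hl, hmax⟩ := Set.exists_max_image (Lam n) (fun l => ∑ j, (l j : ℝ) * x j)
    (finite_Lam n) (nonempty_Lam hN)
  refine ⟨l, hl, fun j k hj hk => ?_⟩
  have hjk : j ≠ k := by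
    rintro rfl
    rw [hj] at hk
    norm_num at hk
  have hmem : l - Pi.single j 2 + Pi.single k 2 ∈ Lam n := by
    refine ⟨fun i => ?_, ?_⟩
    · by_cases h1 : i = j
      · subst h1; simp [hj, hjk]
      · by_cases h2 : i = k
        · subst h2; simp [hk, h1]
        · simpa [h1, h2] using hl.1 i
    · simp [Finset.sum_add_distrib, hl.2]
  have heq : ∑ i, ((l - Pi.single j 2 + Pi.single k 2 : Fin (n + 1) → ℤ) i : ℝ) * x i =
      ∑ i, (l i : ℝ) * x i - 2 * x j + 2 * x k := by
    simp [Pi.single_apply, add_mul, sub_mul, Finset.sum_add_distrib, Finset.sum_sub_distrib,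
      ite_mul]
  have : ∑ i, _ ≤ ∑ i, _ := hmax _ hmem
  rw [heq] at this
  linarith

lemma exists_eq_sum_of_mem_convexHull_support {n : ℕ} (hn : 2 ≤ n) {p : Fin n → ℝ}
    (hp : p ∈ convexHull ℝ (support (SimpleGraph.cycleGraph (n + 1)))) :
    ∃ x : Fin (n + 1) → ℝ, ∑ j, |x j| ≤ 1 ∧ p = ∑ j, x j • edgeVec n j := by
  refine convexHull_min (t := {p | ∃ x : Fin (n + 1) → ℝ, ∑ j, |x j| ≤ 1 ∧
    p = ∑ j, x j • edgeVec n j}) ?_ ?_ hp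
  · intro p hp
    rcases (mem_support_cycleGraph hn _).1 hp with rfl | ⟨i, s, hs, rfl⟩
    · exact ⟨0, by simp, by simp⟩
    · refine ⟨Pi.single i s, ?_, by simp [Pi.single_apply, ite_smul]⟩
      rcases hs with rfl | rfl <;> simp [Pi.single_apply, apply_ite abs]
  · rintro _ ⟨x, hx, rfl⟩ _ ⟨y, hy, rfl⟩ a b ha hb hab
    refine ⟨a • x + b • y, ?_, ?_⟩
    · calc ∑ j, |(a • x + b • y) j| ≤ ∑ j, (a * |x j| + b * |y j|) := by
            refine Finset.sum_le_sum fun j _ => (abs_add_le _ _).trans_eq ?_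
            simp [abs_mul, abs_of_nonneg ha, abs_of_nonneg hb]
        _ = a * ∑ j, |x j| + b * ∑ j, |y j| := by
            rw [Finset.sum_add_distrib, Finset.mul_sum, Finset.mul_sum]
        _ ≤ a * 1 + b * 1 := by gcongr
        _ = 1 := by rw [mul_one, mul_one, hab]
    · simp [add_smul, mul_smul, Finset.sum_add_distrib, Finset.smul_sum]

/-- The coefficients `xⱼ` of a point may be shifted by a common constant. With the `λ` that
separates the two halves of the `xⱼ`, the constant is the coefficient closest to the other half
among those in the half of `x₀`. -/
lemma exists_mem_cell {n : ℕ} (hn : 2 ≤ n) (hN : Even (n + 1)) {p : Fin n → ℝ}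
    (hp : p ∈ convexHull ℝ (support (SimpleGraph.cycleGraph (n + 1)))) :
    ∃ l ∈ Lam n, ∃ i, l i = l 0 ∧ p ∈ convexHull ℝ (cellVertices l i) := by
  obtain ⟨x, hx, rfl⟩ := exists_eq_sum_of_mem_convexHull_support hn hp
  obtain ⟨l, hl, hsep⟩ := exists_mem_Lam_forall_le hN x
  have hs : IsSign l := hl.1
  obtain ⟨i, hi, hmin⟩ := Set.exists_min_image {i | l i = l 0} (fun i => (l i : ℝ) * x i)
    (Set.toFinite _) ⟨0, rfl⟩
  have hnonneg : ∀ j, 0 ≤ (l j : ℝ) * (x j - x i) := by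
    intro j
    by_cases hj : l j = l 0
    · have : (l i : ℝ) * x i ≤ (l j : ℝ) * x j := hmin j hj
      have hij : l j = l i := hj.trans hi.symm
      rw [hij] at this ⊢
      linarith
    · have hi' : l i = l 0 := hi
      rcases hs j with h1 | h1 <;> rcases hs i with h2 | h2
      · omega
      · have := hsep i j h2 h1
        rw [h1]; push_cast; linarith
      · have := hsep j i h1 h2
        rw [h1]; push_cast; linarith
      · omega
  refine ⟨l, hl, i, hi, ?_⟩
  rw [cell_eq_image hn hs]
  have hsucc : ∀ {M : Type} [AddCommMonoid M] (f : Fin (n + 1) → M), f i = 0 →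
      ∑ m, f (i.succAbove m) = ∑ j, f j := by
    intro M _ f hf
    rw [Fin.sum_univ_succAbove f i, hf, zero_add]
  refine ⟨fun m => l (i.succAbove m) * (x (i.succAbove m) - x i), ⟨fun m => hnonneg _, ?_⟩, ?_⟩
  · rw [hsucc (fun j => (l j : ℝ) * (x j - x i)) (by simp)]
    have hl0 : ∑ j, (l j : ℝ) = 0 := by exact_mod_cast hl.2
    calc ∑ j, (l j : ℝ) * (x j - x i) = ∑ j, (l j : ℝ) * x j := by
          simp [mul_sub, Finset.sum_sub_distrib, ← Finset.sum_mul, hl0]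
      _ ≤ ∑ j, |x j| := by
          refine Finset.sum_le_sum fun j _ => ?_
          rcases hs j with h | h
          · simpa [h] using neg_le_abs (x j)
          · simpa [h] using le_abs_self (x j)
      _ ≤ 1 := hx
  · rw [cellMap_apply,
      hsucc (fun j => ((l j : ℝ) * (x j - x i)) • v l j) (by simp)]
    have hv : ∀ j, ((l j : ℝ) * (x j - x i)) • v l j = x j • edgeVec n j - x i • edgeVec n j := by
      intro j
      have hsq : (l j : ℝ) * l j = 1 := by exact_mod_cast hs.mul_self j
      rw [v_eq, smul_smul, ← sub_smul]
      congr 1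
      linear_combination (x j - x i) * hsq
    simp_rw [hv]
    rw [Finset.sum_sub_distrib, ← Finset.smul_sum, sum_edgeVec, smul_zero, sub_zero]

/-! ### The regular subdivision -/

lemma mem_regularSubdivision_cycle_iff {n : ℕ} (hn : 2 ≤ n) (hN : Even (n + 1))
    (T : Set (Fin n → ℝ)) :
    T ∈ regularSubdivision (support (SimpleGraph.cycleGraph (n + 1))) (cycleHeight n) ↔
      ∃ l ∈ Lam n, ∃ i, l i = l 0 ∧ T = convexHull ℝ (cellVertices l i) := by
  rw [mem_regularSubdivision_iff]
  constructor
  · rintro ⟨c, rfl, hdim⟩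
    rw [dim_convexHull] at hdim
    obtain ⟨l, hl, i, hi, hc⟩ := exists_isCertificate_of_dim hn hN c hdim
    exact ⟨l, hl, i, hi, by rw [hc.tightPoints_eq hn hl.1]⟩
  · rintro ⟨l, hl, i, hi, rfl⟩
    obtain ⟨c, hc⟩ := exists_isCertificate hl hi
    exact ⟨c, by rw [hc.tightPoints_eq hn hl.1], dim_cell hn hl.1 i⟩

/-- On a cell with certificate `c`, the functional `c` is the lower envelope of the heights, so it
dominates any other certificate `c'`, with equality exactly on the intersection of the two cells. -/
lemma IsCertificate.isExposed_inter {n : ℕ} (hn : 2 ≤ n) {c c' : Fin n → ℝ} {l l' : Fin (n + 1) → ℤ}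
    {i i' : Fin (n + 1)} (h : IsCertificate c l i) (h' : IsCertificate c' l' i')
    (hl : IsSign l) (hl' : IsSign l') :
    IsExposed ℝ (convexHull ℝ (cellVertices l i))
      (convexHull ℝ (cellVertices l i) ∩ convexHull ℝ (cellVertices l' i')) := by
  have hle : ∀ {c c' : Fin n → ℝ} {l l' : Fin (n + 1) → ℤ} {i i' : Fin (n + 1)},
      IsCertificate c l i → IsCertificate c' l' i' → IsSign l → IsSign l' →
      ∀ x ∈ convexHull ℝ (cellVertices l i), 0 ≤ (c - c') ⬝ᵥ x := by
    intro c c' l l' i i' h h' hl hl' x hx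
    refine convexHull_min (t := {x | 0 ≤ (c - c') ⬝ᵥ x}) ?_
      (convex_halfSpace_ge (dotProductBilin ℝ ℝ (c - c')).isLinear 0) hx
    intro a ha
    let b : support (SimpleGraph.cycleGraph (n + 1)) := ⟨a, cellVertices_subset_support hn hl i ha⟩
    have h1 := ((h.le_and_eq_iff hn hl b).2).2 ha
    have h2 := (h'.le_and_eq_iff hn hl' b).1
    show 0 ≤ (c - c') ⬝ᵥ a
    rw [sub_dotProduct]
    linarith
  have hzero : (0 : Fin n → ℝ) ∈ convexHull ℝ (cellVertices l i) :=
    subset_convexHull _ _ (by rw [cellVertices_eq hn hl]; simp)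
  intro _
  refine ⟨LinearMap.toContinuousLinearMap (dotProductBilin ℝ ℝ (c' - c)), ?_⟩
  have hneg : ∀ x, (c' - c) ⬝ᵥ x = -((c - c') ⬝ᵥ x) := fun x => by
    rw [← neg_dotProduct, neg_sub]
  ext x
  simp only [LinearMap.coe_toContinuousLinearMap', dotProductBilin_apply_apply]
  constructor
  · rintro ⟨hx, hx'⟩
    refine ⟨hx, fun y hy => ?_⟩
    have h1 := hle h h' hl hl' y hy
    have h2 := hle h' h hl' hl x hx'
    rw [hneg y]
    linarith
  · rintro ⟨hx, hmax⟩
    refine ⟨hx, ?_⟩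
    have h0 : (c - c') ⬝ᵥ x = 0 := by
      have h1 := hle h h' hl hl' x hx
      have h2 := hmax 0 hzero
      rw [dotProduct_zero, hneg] at h2
      linarith
    -- Every vertex needed to write `x` is tight for `c'` as well.
    refine convexHull_mono ?_ (mem_convexHull_setOf_eq (dotProductBilin ℝ ℝ (c - c'))
      (fun a ha => hle h h' hl hl' a (subset_convexHull _ _ ha)) hx h0)
    rintro a ⟨ha, ha0⟩
    let b : support (SimpleGraph.cycleGraph (n + 1)) := ⟨a, cellVertices_subset_support hn hl i ha⟩
    have h1 := ((h.le_and_eq_iff hn hl b).2).2 ha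
    refine ((h'.le_and_eq_iff hn hl' b).2).1 ?_
    rw [dotProductBilin_apply_apply, sub_dotProduct] at ha0
    show c' ⬝ᵥ a = _
    rw [← h1]
    show c' ⬝ᵥ a = c ⬝ᵥ a
    linarith

lemma isSimplexIn_cell {n : ℕ} (hn : 2 ≤ n) {l : Fin (n + 1) → ℤ} (hl : IsSign l)
    (i : Fin (n + 1)) : IsSimplexIn (support (SimpleGraph.cycleGraph (n + 1)))
      (convexHull ℝ (cellVertices l i)) :=
  ⟨_, cellVertices_subset_support hn hl i, affineIndependent_cellVertices hn hl i, rfl⟩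

lemma isTriangulation_cycle {n : ℕ} (hn : 2 ≤ n) (hN : Even (n + 1)) :
    IsTriangulation (support (SimpleGraph.cycleGraph (n + 1)))
      (regularSubdivision (support (SimpleGraph.cycleGraph (n + 1))) (cycleHeight n)) := by
  have hmem := mem_regularSubdivision_cycle_iff hn hN
  refine ⟨⟨?_, ?_, ?_, ?_, ?_⟩, ?_⟩
  · refine ((finite_Lam n).prod (Set.finite_univ (α := Fin (n + 1)))).image
      (fun q => convexHull ℝ (cellVertices q.1 q.2)) |>.subset ?_
    intro T hT
    obtain ⟨l, hl, i, -, rfl⟩ := (hmem T).1 hT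
    exact ⟨(l, i), ⟨hl, trivial⟩, rfl⟩
  · intro T hT
    obtain ⟨l, hl, i, -, rfl⟩ := (hmem T).1 hT
    classical
    refine ⟨insert 0 (Finset.univ.image fun m => v l (i.succAbove m)), ?_⟩
    rw [cellVertices_eq hn hl.1]
    simp
  · intro T hT
    obtain ⟨l, hl, i, -, rfl⟩ := (hmem T).1 hT
    exact dim_cell hn hl.1 i
  · intro T hT T' hT'
    obtain ⟨l, hl, i, hi, rfl⟩ := (hmem T).1 hT
    obtain ⟨l', hl', i', hi', rfl⟩ := (hmem T').1 hT'
    obtain ⟨c, hc⟩ := exists_isCertificate hl hi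
    obtain ⟨c', hc'⟩ := exists_isCertificate hl' hi'
    refine ⟨hc.isExposed_inter hn hc' hl.1 hl'.1, ?_⟩
    rw [Set.inter_comm]
    exact hc'.isExposed_inter hn hc hl'.1 hl.1
  · apply subset_antisymm
    · refine Set.sUnion_subset fun T hT => ?_
      obtain ⟨l, hl, i, -, rfl⟩ := (hmem T).1 hT
      exact convexHull_mono (cellVertices_subset_support hn hl.1 i)
    · intro p hp
      obtain ⟨l, hl, i, hi, hpi⟩ := exists_mem_cell hn hN hp
      exact ⟨_, (hmem _).2 ⟨l, hl, i, hi, rfl⟩, hpi⟩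
  · intro T hT
    obtain ⟨l, hl, i, -, rfl⟩ := (hmem T).1 hT
    exact isSimplexIn_cell hn hl.1 i

lemma isUnimodular_cycle {n : ℕ} (hn : 2 ≤ n) (hN : Even (n + 1)) :
    IsUnimodular
      (regularSubdivision (support (SimpleGraph.cycleGraph (n + 1))) (cycleHeight n)) := by
  intro T hT
  obtain ⟨l, hl, i, -, rfl⟩ := (mem_regularSubdivision_cycle_iff hn hN T).1 hT
  obtain ⟨s, hs, hs'⟩ := isSimplexIn_cell hn hl.1 i
  exact ⟨⟨s, hs.trans (support_subset_latticePoints _), hs'⟩, normalizedVolume_cell hn hl.1 i⟩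

end AdjacencyPolytope

theorem mainTheorem1 (N n : ℕ) (hNn : N = n + 1) (hN : Even N) (hN2 : 2 < N) :
    let S : Set (Fin n → ℝ) := AdjacencyPolytope.support (SimpleGraph.cycleGraph (n + 1))
    let Δ : Set (Set (Fin n → ℝ)) :=
      AdjacencyPolytope.regularSubdivision S
        (fun a : S => ((AdjacencyPolytope.height a : ℤ) : ℝ))
    AdjacencyPolytope.IsTriangulation S Δ ∧
      AdjacencyPolytope.IsUnimodular Δ ∧
      Δ = ⋃ l ∈ AdjacencyPolytope.Lam n, AdjacencyPolytope.deltaPlus l := by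
  subst hNn
  have hn : 2 ≤ n := by omega
  refine ⟨AdjacencyPolytope.isTriangulation_cycle hn hN,
    AdjacencyPolytope.isUnimodular_cycle hn hN, ?_⟩
  ext T
  rw [Set.mem_iUnion₂]
  exact (AdjacencyPolytope.mem_regularSubdivision_cycle_iff hn hN T).trans
    (exists_congr fun l => exists_prop.symm)
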